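/- **Setting.** Let $G$ be a graph on a finite node set $V$ with $n$ nodes, let $z\in\{0,1\}^V$ be the treatment assignments (held fixed), and let $n_0$ be the number of untreated nodes. For $k\ge 0$ let $G_i^z(k)$ be the $k$-hop neighbourhood of node $i$ with ego $i$, labelled with the treatments of its nodes. Let $\gamma_0$ be a mapping from such labelled neighbourhoods to features which is *nested*: $\gamma_0(G_i^z(k))=\gamma_0(G_j^z(k))$ implies $\gamma_0(G_i^z(k'))=\gamma_0(G_j^z(k'))$ for $1\le k'\le k$. Let $d(k)$ be the number of distinct features $\gamma_0(G_i^z(k))$ over the untreated $i$, and let $X_k\in\mathbb R^{n_0\times d(k)}$ be the matrix whose row for the untreated node $i$ is the standard basis vector of the feature of $i$; let $H_k$ be the orthogonal projection onto its column space. For an interference function $f$ with $|f(\gamma_0(G_i^z(k_0)))|\le M$ for all $i$, the observed outcomes of the untreated nodes are $$y_{obs}=X_{k_0}\beta^0_{k_0}+\sigma_0u,\qquad u\sim N(0,I_{n_0}),\ \sigma_0>0,$$ where $\beta^0_{k_0}$ is the vector of the values of $f$ at the features for $k_0$. Assume that $k_0\ge1$ is the smallest $k\geq 0$ for which $X_k\beta=X_{k_0}\beta^0_{k_0}$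 has a solution $\beta$, and put $$C_{\min}=\min_{0\le k<k_0}\ \min_{\beta\in\mathbb R^{d(k)}}\frac{\|X_{k_0}\beta^0_{k_0}-X_k\beta\|_2^2}{n_0(k_0-k)} .$$ **Candidate set.** Let $u_1^*,\dots,u_B^*\sim N(0,I_{n_0})$ be i.i.d. and independent of $u$, and let $\hat k_b$ be the $k$-component of a minimizer of $\|y_{obs}-X_k\beta-\sigma u_b^*\|_2^2+\lambda k$ over $0\le k\le n$, $\beta\in\mathbb R^{d(k)}$, $\sigma\in\mathbb R$. Put $\mathcal S_B=\{\hat k_1,\dots,\hat k_B\}$. **Confidence set.** For $Y\in\mathbb R^{n_0}$ and a finite set $\mathcal S$ of candidates let $\hat k_{\mathcal S}(Y)$ be a minimizer over $k'\in\mathcal S$ of $\min_{\beta}\{\|Y-X_{k'}\beta\|_2^2+\lambda'k'\}$, where $\lambda'\in\mathbb R$. (Ties in both minimizations are broken by an arbitrary fixed rule.) Let $W_k(Y)=(H_kY,\|(I-H_k)Y\|_2)$. Let $p(j\mid w)$ be the conditional probability of $\hat k_{\mathcal S}(Y)=j$ given $W_k(Y)=w$ under $Y=X_k\beta+\sigma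 u^*$ with $u^*\sim N(0,I_{n_0})$; it is free of $(\beta,\sigma)$ and, for $w=(a,b)$, it is the probability that $\hat k_{\mathcal S}\big(a+b\,(I-H_k)u^*/\|(I-H_k)u^*\|_2\big)=j$. Put $$\mathcal F(j\mid w)=\sum_{j':\,p(j'\mid w)\le p(j\mid w)}p(j'\mid w),\qquad \mathcal B_\alpha(k,w)=\{0\le j\le n_0:\mathcal F(j\mid w)\ge\alpha\},$$ and, with $\mathcal S=\mathcal S_B$ throughout, $$\bar\Gamma_\alpha(y_{obs})=\{k\in\mathcal S_B:\ \hat k_{\mathcal S_B}(y_{obs})\in\mathcal B_\alpha(k,W_k(y_{obs}))\}.$$ **Theorem.** Let $\sigma_0,m_1,m_2>0$, $M\in\mathbb R$, $\alpha\in(0,1)$ and a finite $B\ge1$ be given. There are $c_2>0$ and a sequence $r(n_0)=o(e^{-c_2n_0})$ as $n_0\to\infty$, depending only on these quantities, such that in every setting as above with $$\frac{\lambda}{n_0}\in\Big[\sigma_0^2+\frac{2\sigma_0^2}{n_0}+m_1,\ \min\Big\{0.015\,C_{\min}-\frac{3\sigma_0^2\ln2}{n_0},\ 0.015\,C_{\min}-\frac{\sigma_0^2d(k_0)}{n_0}\Big\}-m_2\Big]$$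 and $$\frac{\log(2k_0)}{n_0-d(k_0)-1}<\log\frac53$$ we have $$\mathbb P\big(k_0\in\bar\Gamma_\alpha(y_{obs})\big)\ \ge\ 1-\alpha-r(n_0).$$ -/

import Mathlib

open MeasureTheory ProbabilityTheory Filter Asymptotics
open scoped Topology

noncomputable section

namespace HNCI

/-- A graph with a distinguished node (the ego) and with the treated nodes marked. -/
structure EgoNet (V : Type*) where
  ego : V
  nodes : Set V
  edges : Set (Sym2 V)
  treated : Set V

/-- The `k`-hop neighbourhood of node `i` in `G`, labelled with the treatments `z`: the subgraph
induced on all nodes of depth at most `k` from `i`. It stays constant once `k` exceeds the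
maximal depth. -/
def egoNet {V : Type*} (G : SimpleGraph V) (z : V → Bool) (i : V) (k : ℕ) : EgoNet V where
  ego := i
  nodes := {j | G.edist i j ≤ k}
  edges := {e | e ∈ G.edgeSet ∧ ∀ j ∈ e, G.edist i j ≤ k}
  treated := {j | G.edist i j ≤ k ∧ z j = true}

/-- An interference network with realized treatments and a known feature mapping. -/
structure Network (V F : Type*) where
  /-- the interference network `G` -/
  graph : SimpleGraph V
  /-- the treatment assignments (`true` means treated) -/
  treat : V → Bool
  /-- the mapping `γ₀` from labelled neighbourhoods to features -/
  feature : EgoNet V → F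

namespace Network

variable {V F : Type*} (D : Network V F)

/-- `γ₀(G_i^z(k))`. -/
def featureAt (k : ℕ) (i : V) : F := D.feature (egoNet D.graph D.treat i k)

/-- The nested matching property of `γ₀` on the network. -/
def NestedMatching : Prop :=
  ∀ (i j : V) (k k' : ℕ), 1 ≤ k' → k' ≤ k →
    D.featureAt k i = D.featureAt k j → D.featureAt k' i = D.featureAt k' j

/-- The untreated nodes. -/
abbrev Untreated : Type _ := {i : V // D.treat i = false}

/-- The collection `Ê_k` of the distinct features of the untreated nodes. -/
abbrev Features (k : ℕ) : Type _ := Set.range fun i : D.Untreated => D.featureAt k i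

variable [Fintype V]

/-- The number `n₀` of untreated nodes. -/
def n₀ : ℕ := Fintype.card D.Untreated

instance (k : ℕ) : Fintype (D.Features k) := Fintype.ofFinite _

/-- The number `d(k) = |Ê_k|` of distinct features of untreated nodes. -/
def d (k : ℕ) : ℕ := Fintype.card (D.Features k)

/-- Outcome vectors of the untreated nodes, `ℝ^{n₀}` with the Euclidean norm. -/
abbrev Vec : Type _ := EuclideanSpace ℝ D.Untreated

open Classical in
/-- The design matrix `X_k`: the row of node `i` is the standard basis vector of the feature
of `i`. -/
def X (k : ℕ) : Matrix D.Untreated (D.Features k) ℝ :=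
  Matrix.of fun i g => if D.featureAt k i = g then 1 else 0

/-- The vector `X_k β`. -/
def Xmul (k : ℕ) (β : D.Features k → ℝ) : D.Vec :=
  WithLp.toLp 2 ((D.X k).mulVec β)

/-- The column space of `X_k`. -/
def colSpace (k : ℕ) : Submodule ℝ D.Vec :=
  Submodule.span ℝ (Set.range fun g => WithLp.toLp 2 ((D.X k).col g))

/-- The orthogonal projection `H_k` onto the column space of `X_k`. -/
def H (k : ℕ) : D.Vec →L[ℝ] D.Vec := (D.colSpace k).starProjection

/-- The vector `β⁰_{k₀}` of true interference function values over the features. -/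
def β₀ (f : F → ℝ) (k₀ : ℕ) : D.Features k₀ → ℝ := fun g => f g

/-- The mean outcome vector `X_{k₀} β⁰_{k₀}`. -/
def mean (f : F → ℝ) (k₀ : ℕ) : D.Vec := D.Xmul k₀ (D.β₀ f k₀)

/-- The observed outcomes of the untreated nodes, `y = X_{k₀} β⁰_{k₀} + σ₀ u`. -/
def yobs (f : F → ℝ) (k₀ : ℕ) (σ₀ : ℝ) (u : D.Vec) : D.Vec := D.mean f k₀ + σ₀ • u

/-- Identifiability: `k₀` is the smallest `k` whose design can represent the mean outcomes. -/
def Identifiable (f : F → ℝ) (k₀ : ℕ) : Prop :=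
  IsLeast {k : ℕ | ∃ β : D.Features k → ℝ, D.Xmul k β = D.mean f k₀} k₀

/-- The separation measure `C_min` between the true model and the under-specified ones
(meaningful for `k₀ ≥ 1`). -/
def Cmin (f : F → ℝ) (k₀ : ℕ) : ℝ :=
  ⨅ k : Fin k₀, ⨅ β : D.Features k → ℝ,
    ‖D.mean f k₀ - D.Xmul k β‖ ^ 2 / ((D.n₀ : ℝ) * ((k₀ : ℝ) - (k : ℕ)))

/-! ### Candidate set -/

/-- The objective `‖y - X_k β - σ u*‖² + lam k`. -/
def reproObj (lam : ℝ) (y ustar : D.Vec) (k : ℕ) (β : D.Features k → ℝ) (σ : ℝ) : ℝ :=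
  ‖y - D.Xmul k β - σ • ustar‖ ^ 2 + lam * k

/-- The `k`-components, `0 ≤ k ≤ n`, of the minimizers `(k, β, σ)` of the objective. -/
def reproArgmin (lam : ℝ) (y ustar : D.Vec) : Set ℕ :=
  {k | k ≤ Fintype.card V ∧ ∃ (β : D.Features k → ℝ) (σ : ℝ),
    ∀ k' ≤ Fintype.card V, ∀ (β' : D.Features k' → ℝ) (σ' : ℝ),
      D.reproObj lam y ustar k β σ ≤ D.reproObj lam y ustar k' β' σ'}

/-- The candidate set `S_B` obtained from the repro copies `u*_1, …, u*_B`; ties between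
minimizers are broken by `pick`. -/
def candidateSet (pick : Set ℕ → ℕ) (lam : ℝ) {B : ℕ} (y : D.Vec) (ustar : Fin B → D.Vec) :
    Finset ℕ :=
  Finset.univ.image fun b => pick (D.reproArgmin lam y (ustar b))

/-! ### Confidence set -/

/-- The `k`-components of the minimizers of `‖Y - X_k β‖² + lam' k` over `k ∈ S` and `β`. -/
def nuclearArgmin (lam' : ℝ) (S : Finset ℕ) (Y : D.Vec) : Set ℕ :=
  {k | k ∈ S ∧ ∃ β : D.Features k → ℝ,
    ∀ k' ∈ S, ∀ β' : D.Features k' → ℝ,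
      ‖Y - D.Xmul k β‖ ^ 2 + lam' * k ≤ ‖Y - D.Xmul k' β'‖ ^ 2 + lam' * k'}

/-- The nuclear statistic `k̂(Y)` for the candidate set `S`. -/
def nuclear (pick : Set ℕ → ℕ) (lam' : ℝ) (S : Finset ℕ) (Y : D.Vec) : ℕ :=
  pick (D.nuclearArgmin lam' S Y)

/-- `W_k(Y) = (H_k Y, ‖(I - H_k) Y‖)`. -/
def W (k : ℕ) (Y : D.Vec) : D.Vec × ℝ := (D.H k Y, ‖Y - D.H k Y‖)

/-- The repro sample `a + b (I - H_k) u* / ‖(I - H_k) u*‖` for `w = (a, b)`. -/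
def reproSample (k : ℕ) (w : D.Vec × ℝ) (ustar : D.Vec) : D.Vec :=
  w.1 + (w.2 / ‖ustar - D.H k ustar‖) • (ustar - D.H k ustar)

/-- The conditional probability mass function `p(j | w) = P{k̂(Y) = j | W_k(Y) = w}` under
`Y = X_k β + σ u`, `u ∼ N(0, I)`. The direction of `(I - H_k) u` is independent of `W_k(Y)`, so
given `W_k(Y) = w` the vector `Y` is distributed as the repro sample, whatever `β` and `σ`. -/
def condPMF (pick : Set ℕ → ℕ) (lam' : ℝ) (S : Finset ℕ) (k : ℕ) (w : D.Vec × ℝ) (j : ℕ) : ℝ :=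
  (stdGaussian D.Vec).real {ustar | D.nuclear pick lam' S (D.reproSample k w ustar) = j}

open Classical in
/-- `𝓕(j | w)`, the sum of `p(j' | w)` over all `j'` with `p(j' | w) ≤ p(j | w)`
(`p(· | w)` vanishes outside `S`). -/
def condF (pick : Set ℕ → ℕ) (lam' : ℝ) (S : Finset ℕ) (k : ℕ) (w : D.Vec × ℝ) (j : ℕ) : ℝ :=
  ∑ j' ∈ S with D.condPMF pick lam' S k w j' ≤ D.condPMF pick lam' S k w j,
    D.condPMF pick lam' S k w j'

/-- The Borel set `𝓑_α(k, w)`. -/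
def borelSet (pick : Set ℕ → ℕ) (lam' : ℝ) (S : Finset ℕ) (α : ℝ) (k : ℕ) (w : D.Vec × ℝ) :
    Set ℕ :=
  {j | j ≤ D.n₀ ∧ α ≤ D.condF pick lam' S k w j}

/-- The confidence set for `k₀` computed from the data `y` with the candidate set `S`. -/
def confidenceSet (pick : Set ℕ → ℕ) (lam' α : ℝ) (S : Finset ℕ) (y : D.Vec) : Set ℕ :=
  {k | k ∈ S ∧ D.nuclear pick lam' S y ∈ D.borelSet pick lam' S α k (D.W k y)}

/-- The joint law of the error vector `u` and the `B` repro copies: all independent and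
`N(0, I_{n₀})`. -/
def jointLaw (B : ℕ) : Measure (D.Vec × (Fin B → D.Vec)) :=
  (stdGaussian D.Vec).prod (Measure.pi fun _ : Fin B => stdGaussian D.Vec)

/-- The probability that the confidence set contains `k₀`. -/
def coverage (pick : Set ℕ → ℕ) (lam lam' α : ℝ) (B : ℕ) (f : F → ℝ) (k₀ : ℕ) (σ₀ : ℝ) : ℝ :=
  (D.jointLaw B).real {ω | k₀ ∈ D.confidenceSet pick lam' α
    (D.candidateSet pick lam (D.yobs f k₀ σ₀ ω.1) ω.2) (D.yobs f k₀ σ₀ ω.1)}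

end Network

end HNCI

end

/-! Coverage is won in the candidate set. Off an event of exponentially small probability every
repro copy selects `k₀`, so the candidate set is `{k₀}`; the nuclear statistic is then constant, its
conditional law is a point mass, `condF` equals 1 and `k₀` is accepted. The level `α` is therefore
never spent.

Selection is compared with the true coefficients and `σ = 0`, where the objective is `σ₀²‖u‖² + lam
k₀`. If `σ₀²‖u‖² < lam`, which fails only on a chi-square tail event, every `k > k₀` loses by its
penalty alone. For `k < k₀` the missed part of the mean has squared norm at least `Cmin n₀ (k₀ -
k)`, a large multiple of `lam (k₀ - k)`. It outweighs the noise unless the artificial noise absorbs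
it, that is, unless the copy, projected onto the complement of the column space, is nearly parallel
to it (`lt_norm_residual_sq`). By `stdGaussian_alignment_tail` this has probability exponentially
small in the codimension.

Uniformity comes from `M`. The penalty window forces `Cmin ≥ σ₀²`. A bounded mean cannot be that far
from a column space of small codimension, so the codimension grows linearly in `n₀`; and the zero
fit at `k = 0` gives `k₀ ≤ M²/σ₀²`, so the union bound has boundedly many terms. -/

namespace HNCI

/-! ### Gaussian tail bounds. -/

section Gaussian

theorem integral_exp_mul_sq_gaussianReal {s : ℝ} (hs : s < 1 / 2) :
    ∫ x, Real.exp (s * x ^ 2) ∂(gaussianReal 0 1) = (√(1 - 2 * s))⁻¹ := by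
  rw [integral_gaussianReal_eq_integral_smul one_ne_zero, gaussianPDFReal_def]
  have h : ∀ x : ℝ, ((√(2 * Real.pi * ((1 : NNReal) : ℝ)))⁻¹ *
      Real.exp (-(x - 0) ^ 2 / (2 * ((1 : NNReal) : ℝ)))) • Real.exp (s * x ^ 2) =
      (√(2 * Real.pi))⁻¹ * Real.exp (-(1 / 2 - s) * x ^ 2) := by
    intro x
    rw [smul_eq_mul, mul_assoc, ← Real.exp_add, NNReal.coe_one, mul_one]
    congr 2
    ring
  simp_rw [h]
  rw [integral_const_mul, integral_gaussian, ← Real.sqrt_inv, ← Real.sqrt_inv,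
    ← Real.sqrt_mul (by positivity)]
  congr 1
  have h1 : (1 : ℝ) / 2 - s ≠ 0 := by linarith
  have h2 : (1 : ℝ) - 2 * s ≠ 0 := by linarith
  have h3 := Real.pi_ne_zero
  have h4 : (1 : ℝ) / 2 - s = (1 - 2 * s) / 2 := by ring
  rw [h4]
  field_simp

theorem integrable_exp_mul_sq_gaussianReal {s : ℝ} (hs : s < 1 / 2) :
    Integrable (fun x => Real.exp (s * x ^ 2)) (gaussianReal 0 1) := by
  -- A non-integrable function has integral 0 by convention, but the computed value is positive.
  by_contra h
  have h1 := integral_exp_mul_sq_gaussianReal hs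
  rw [integral_undef h] at h1
  have : 0 < (√(1 - 2 * s))⁻¹ := by
    have : 0 < 1 - 2 * s := by linarith
    positivity
  linarith

variable {E : Type*} [NormedAddCommGroup E] [InnerProductSpace ℝ E] [FiniteDimensional ℝ E]
  [MeasurableSpace E] [BorelSpace E]

/-- Chernoff bound for a quadratic form that is diagonal in an orthonormal basis. -/
theorem stdGaussian_quadratic_tail {ι : Type*} [Fintype ι] (b : OrthonormalBasis ι ℝ E)
    (c : ι → ℝ) (hc : ∀ i, c i < 1 / 2) (a : ℝ) :
    (stdGaussian E).real {u | a ≤ ∑ i, c i * (inner ℝ (b i) u) ^ 2} ≤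
      Real.exp (-a) * ∏ i, (√(1 - 2 * c i))⁻¹ := by
  classical
  have hcoord : ∀ (x : ι → ℝ) (i : ι), inner ℝ (b i) (∑ j, x j • b j) = x i := by
    intro x i
    simp [inner_sum, inner_smul_right, orthonormal_iff_ite.1 b.orthonormal]
  have hset : MeasurableSet {u : E | a ≤ ∑ i, c i * (inner ℝ (b i) u) ^ 2} :=
    (isClosed_le continuous_const (by fun_prop)).measurableSet
  have hmap : Measurable (fun x : ι → ℝ => ∑ i, x i • b i) := by fun_prop
  rw [stdGaussian_eq_map_pi_orthonormalBasis b, map_measureReal_apply hmap hset]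
  simp only [Set.preimage_ofPred_eq, hcoord]
  have hexp : ∀ x : ι → ℝ, Real.exp (1 * ∑ i, c i * x i ^ 2) =
      ∏ i, Real.exp (c i * x i ^ 2) := by
    intro x
    rw [one_mul, Real.exp_sum]
  have key := measure_ge_le_exp_mul_mgf (μ := Measure.pi fun _ : ι => gaussianReal 0 1)
    (X := fun x => ∑ i, c i * x i ^ 2) (t := 1) a zero_le_one (by
      simp_rw [hexp]
      exact Integrable.fintype_prod (fun i => integrable_exp_mul_sq_gaussianReal (hc i)))
  refine key.trans (le_of_eq ?_)
  rw [mgf]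
  simp_rw [hexp]
  rw [integral_fintype_prod_eq_prod (f := fun i x => Real.exp (c i * x ^ 2))]
  simp_rw [integral_exp_mul_sq_gaussianReal (hc _)]
  simp

theorem inv_sqrt_one_sub_le_exp {s : ℝ} (hs : 0 ≤ s) (hs' : s ≤ 1 / 4) :
    (√(1 - 2 * s))⁻¹ ≤ Real.exp (s + 2 * s ^ 2) := by
  have h0 : 0 < 1 - 2 * s := by linarith
  rw [← Real.sqrt_inv, Real.sqrt_le_left (Real.exp_pos _).le, ← Real.exp_nat_mul,
    inv_le_iff_one_le_mul₀ h0]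
  have h1 := Real.quadratic_le_exp_of_nonneg (x := ((2 : ℕ) : ℝ) * (s + 2 * s ^ 2))
    (by positivity)
  refine le_trans ?_ (mul_le_mul_of_nonneg_right h1 h0.le)
  push_cast
  have h2 : 0 ≤ s ^ 2 * (1 - 2 * s) := by positivity
  have h3 : 0 ≤ s ^ 3 := by positivity
  have h4 : 0 ≤ s ^ 4 * (1 - 2 * s) := by positivity
  nlinarith [mul_nonneg h3 h0.le]

/-- Upper tail of the chi-square distribution. -/
theorem stdGaussian_norm_sq_tail {t : ℝ} (ht : 0 < t) :
    (stdGaussian E).real {u | (Module.finrank ℝ E : ℝ) * (1 + t) ≤ ‖u‖ ^ 2} ≤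
      Real.exp (-(min (t / 4) (1 / 4) * t / 2) * Module.finrank ℝ E) := by
  -- The exponent per dimension is `-s t + 2 s²`; `s ≤ t / 4` makes it at most `-s t / 2`, and `s ≤
  -- 1 / 4` admits the bound on the moment generating function.
  set s := min (t / 4) (1 / 4) with hs
  have hs0 : 0 < s := by positivity
  have hs1 : s ≤ 1 / 4 := min_le_right _ _
  have hs2 : s ≤ t / 4 := min_le_left _ _
  set n := Module.finrank ℝ E with hn
  have key := stdGaussian_quadratic_tail (stdOrthonormalBasis ℝ E) (fun _ => s)
    (fun _ => by linarith) (s * (n * (1 + t)))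
  have hset : {u : E | s * (n * (1 + t)) ≤
      ∑ i, s * (inner ℝ (stdOrthonormalBasis ℝ E i) u) ^ 2} =
      {u | (n : ℝ) * (1 + t) ≤ ‖u‖ ^ 2} := by
    ext u
    simp only [Set.mem_ofPred_eq]
    rw [← Finset.mul_sum, (stdOrthonormalBasis ℝ E).sum_sq_inner_right,
      mul_le_mul_iff_right₀ hs0]
  rw [hset] at key
  refine key.trans ?_
  rw [Finset.prod_const, Finset.card_univ, Fintype.card_fin]
  calc Real.exp (-(s * (n * (1 + t)))) * (√(1 - 2 * s))⁻¹ ^ n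
      ≤ Real.exp (-(s * (n * (1 + t)))) * Real.exp (s + 2 * s ^ 2) ^ n := by
        gcongr
        exact inv_sqrt_one_sub_le_exp hs0.le hs1
    _ = Real.exp (-(s * (n * (1 + t))) + n * (s + 2 * s ^ 2)) := by
        rw [← Real.exp_nat_mul, ← Real.exp_add]
    _ ≤ _ := by
        apply Real.exp_le_exp.2
        have : 0 ≤ (n : ℝ) * s * (t / 4 - s) := by
          have : 0 ≤ t / 4 - s := by linarith
          positivity
        nlinarith

/-- A Gaussian vector projected onto a subspace of large dimension is rarely almost parallel to
a given vector of the subspace. -/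
theorem stdGaussian_alignment_tail (K : Submodule ℝ E) {e : E} (he : e ∈ K) :
    (stdGaussian E).real {u | 0.9 * (‖e‖ ^ 2 * ‖K.starProjection u‖ ^ 2) < (inner ℝ e u) ^ 2} ≤
      4 * (1 / 2) ^ Module.finrank ℝ K := by
  classical
  by_cases h0 : e = 0
  · subst h0
    simp only [inner_zero_left, norm_zero]
    norm_num
  have hne : 0 < ‖e‖ := norm_pos_iff.2 h0
  set e₁ : K := ‖e‖⁻¹ • (⟨e, he⟩ : K) with he₁
  have hnorm : ‖e₁‖ = 1 := by
    rw [he₁, norm_smul, norm_inv, norm_norm, Submodule.coe_norm]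
    exact inv_mul_cancel₀ hne.ne'
  have ho : Orthonormal ℝ ((↑) : ({e₁} : Set K) → K) := by
    rw [orthonormal_iff_ite]
    rintro ⟨i, hi⟩ ⟨j, hj⟩
    obtain rfl := Set.mem_singleton_iff.1 hi
    obtain rfl := Set.mem_singleton_iff.1 hj
    simp [hnorm]
  -- The unit vector along `e` is extended to a basis of `K` and then of `E`, so that both sides of
  -- the event become diagonal.
  obtain ⟨w, bK, hw, hbK⟩ := ho.exists_orthonormalBasis_extension
  have ho' : Orthonormal ℝ ((↑) : ((fun x : K => (x : E)) '' (w : Set K)) → E) := by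
    have h1 : Orthonormal ℝ (fun i : w => ((bK i : K) : E)) :=
      bK.orthonormal.comp_linearIsometry K.subtypeₗᵢ
    have h2 := (orthonormal_subtype_range
      (v := fun i : w => ((bK i : K) : E)) h1.linearIndependent.injective).2 h1
    convert h2 using 2 <;> simp [hbK, Set.image_eq_range]
  obtain ⟨w', b, hw', hb⟩ := ho'.exists_orthonormalBasis_extension
  set A : Finset E := w.image (fun x : K => (x : E)) with hA
  have hAK : ∀ x ∈ A, x ∈ K := by
    intro x hx
    obtain ⟨y, -, rfl⟩ := Finset.mem_image.1 hx
    exact y.2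
  have hAw : A ⊆ w' := by
    intro x hx
    apply hw'
    simpa [hA] using hx
  have hAcard : A.card = Module.finrank ℝ K := by
    rw [hA, Finset.card_image_of_injective _ Subtype.val_injective,
      Module.finrank_eq_card_basis bK.toBasis, Fintype.card_coe]
  have heA : (e₁ : E) ∈ A := Finset.mem_image_of_mem _ (hw rfl)
  have hval : ∀ i : w', b i = i := fun i => by rw [hb]
  -- The event says that the squared coordinate along `e₁` exceeds 9 times the sum of the other
  -- squared coordinates in `K`. Scaled by 1/4, the Chernoff factors are `√2 ≤ 2` for `e₁` and
  -- `1/√5.5 ≤ 1/2` for each other direction.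
  set c : E → ℝ := fun x => if x = (e₁ : E) then 1 / 4 else if x ∈ A then -(9 / 4) else 0 with hc
  have key := stdGaussian_quadratic_tail b (fun i => c i) (fun i => by
    simp only [hc]; split_ifs <;> norm_num) 0
  have hsumle : ∀ u : E, ∑ x ∈ A, (inner ℝ x u) ^ 2 ≤ ‖K.starProjection u‖ ^ 2 := by
    intro u
    have h1 : ∀ x ∈ A, (inner ℝ x u) ^ 2 = (inner ℝ x (K.starProjection u)) ^ 2 := by
      intro x hx
      rw [← Submodule.inner_starProjection_left_eq_right,
        Submodule.starProjection_eq_self_iff.2 (hAK x hx)]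
    rw [Finset.sum_congr rfl h1, ← b.sum_sq_inner_right (K.starProjection u)]
    simp_rw [hval]
    rw [Finset.sum_coe_sort w' (fun x => (inner ℝ x (K.starProjection u)) ^ 2)]
    exact Finset.sum_le_sum_of_subset_of_nonneg hAw (fun _ _ _ => sq_nonneg _)
  have hsub : {u : E | 0.9 * (‖e‖ ^ 2 * ‖K.starProjection u‖ ^ 2) < (inner ℝ e u) ^ 2} ⊆
      {u | 0 ≤ ∑ i, c (i : w') * (inner ℝ (b i) u) ^ 2} := by
    intro u hu
    simp only [Set.mem_ofPred_eq] at hu ⊢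
    simp_rw [hval]
    rw [Finset.sum_coe_sort w' (fun x => c x * (inner ℝ x u) ^ 2),
      ← Finset.sum_subset hAw (fun x _ hx => by
        simp only [hc]
        rw [if_neg (fun h : x = e₁ => hx (h ▸ heA)), if_neg hx, zero_mul]),
      ← Finset.add_sum_erase _ _ heA]
    have h1 : ∑ x ∈ A.erase (e₁ : E), c x * (inner ℝ x u) ^ 2 =
        -(9 / 4) * ∑ x ∈ A.erase (e₁ : E), (inner ℝ x u) ^ 2 := by
      rw [Finset.mul_sum]
      refine Finset.sum_congr rfl fun x hx => ?_
      simp only [hc]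
      rw [if_neg (Finset.ne_of_mem_erase hx), if_pos (Finset.mem_of_mem_erase hx)]
    have h2 := hsumle u
    rw [← Finset.add_sum_erase _ _ heA] at h2
    have h3 : inner ℝ e u = ‖e‖ * inner ℝ (e₁ : E) u := by
      rw [he₁]
      simp only [Submodule.coe_smul, real_inner_smul_left]
      field_simp
    rw [h3, mul_pow] at hu
    have h4 : 0.9 * ‖K.starProjection u‖ ^ 2 < (inner ℝ (e₁ : E) u) ^ 2 := by
      have : 0 < ‖e‖ ^ 2 := by positivity
      nlinarith
    rw [h1]
    simp only [hc, if_pos]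
    norm_num at h4 ⊢
    linarith
  refine (measureReal_mono hsub).trans (key.trans ?_)
  rw [neg_zero, Real.exp_zero, one_mul,
    Finset.prod_coe_sort w' (fun x => (√(1 - 2 * c x))⁻¹),
    ← Finset.prod_subset hAw (fun x _ hx => by
        simp only [hc]
        rw [if_neg (fun h : x = e₁ => hx (h ▸ heA)), if_neg hx]
        simp),
    ← Finset.mul_prod_erase _ _ heA]
  have h5 : (√(1 - 2 * c e₁))⁻¹ ≤ 2 := by
    simp only [hc, if_pos]
    rw [inv_le_comm₀ (by norm_num) (by norm_num)]
    apply Real.le_sqrt_of_sq_le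
    norm_num
  have h6 : ∏ x ∈ A.erase (e₁ : E), (√(1 - 2 * c x))⁻¹ ≤
      ∏ x ∈ A.erase (e₁ : E), (1 / 2 : ℝ) := by
    refine Finset.prod_le_prod (fun _ _ => by positivity) fun x hx => ?_
    simp only [hc]
    rw [if_neg (Finset.ne_of_mem_erase hx), if_pos (Finset.mem_of_mem_erase hx), one_div]
    apply inv_anti₀ (by norm_num)
    apply Real.le_sqrt_of_sq_le
    norm_num
  rw [Finset.prod_const] at h6
  have h7 : A.card = (A.erase (e₁ : E)).card + 1 := (Finset.card_erase_add_one heA).symm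
  rw [← hAcard, h7, pow_succ]
  have h8 : (0 : ℝ) < (1 / 2) ^ (A.erase (e₁ : E)).card := by positivity
  calc _ ≤ 2 * (1 / 2 : ℝ) ^ (A.erase (e₁ : E)).card :=
        mul_le_mul h5 h6 (Finset.prod_nonneg fun _ _ => by positivity) (by norm_num)
    _ = _ := by ring

end Gaussian

/-! ### Geometry of least squares residuals. -/

/-- Least squares problems over the range of a linear map have a solution. -/
theorem exists_forall_norm_sub_le {P E : Type*} [AddCommGroup P] [Module ℝ P]
    [NormedAddCommGroup E] [InnerProductSpace ℝ E] [FiniteDimensional ℝ E]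
    (L : P →ₗ[ℝ] E) (y : E) : ∃ p, ∀ q, ‖y - L p‖ ≤ ‖y - L q‖ := by
  obtain ⟨p, hp⟩ := (LinearMap.range L).starProjection_apply_mem y
  refine ⟨p, fun q => ?_⟩
  rw [hp, Submodule.starProjection_minimal]
  exact ciInf_le ⟨0, Set.forall_mem_range.mpr fun _ => norm_nonneg _⟩
    (⟨L q, q, rfl⟩ : LinearMap.range L)

/-- A model that misses a large part `μ` of the signal has a large residual, provided that the
artificial noise `v` is not almost parallel to what is missed. -/
theorem lt_norm_residual_sq {E : Type*} [NormedAddCommGroup E] [InnerProductSpace ℝ E]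
    (K : Submodule ℝ E) [K.HasOrthogonalProjection] {μ u v x : E} (hx : x ∈ Kᗮ)
    {σ₀ lam δ : ℝ} (σ : ℝ) (hσ₀ : 0 < σ₀) (hδ : 1 ≤ δ) (hu : σ₀ ^ 2 * ‖u‖ ^ 2 < lam)
    (hμ : 62.5 * (lam * δ) ≤ ‖K.starProjection μ‖ ^ 2)
    (hv : (inner ℝ (K.starProjection μ) v) ^ 2 ≤
      0.9 * (‖K.starProjection μ‖ ^ 2 * ‖K.starProjection v‖ ^ 2)) :
    σ₀ ^ 2 * ‖u‖ ^ 2 + lam * δ < ‖μ + σ₀ • u - x - σ • v‖ ^ 2 := by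
  have hlam : 0 < lam := lt_of_le_of_lt (by positivity) hu
  set p := K.starProjection μ with hp
  set w := K.starProjection v with hw
  have hpw : inner ℝ p v = inner ℝ p w := by
    rw [hw, ← Submodule.inner_starProjection_left_eq_right, hp,
      Submodule.starProjection_eq_self_iff.2 (K.starProjection_apply_mem μ)]
  rw [hpw] at hv
  -- By AM-GM the cross term is at most `0.9 ‖p‖² + σ² ‖w‖²`, so no choice of `σ` removes more than
  -- nine tenths of `‖p‖²`.
  have h1 : 0.1 * ‖p‖ ^ 2 ≤ ‖p - σ • w‖ ^ 2 := by
    rw [norm_sub_sq_real, inner_smul_right, norm_smul, mul_pow, Real.norm_eq_abs, sq_abs]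
    have h2 : (σ * inner ℝ p w) ^ 2 ≤ (0.9 * ‖p‖ ^ 2) * (σ ^ 2 * ‖w‖ ^ 2) := by
      rw [mul_pow]
      nlinarith [mul_le_mul_of_nonneg_left hv (sq_nonneg σ)]
    have h3 : 2 * (σ * inner ℝ p w) ≤ 0.9 * ‖p‖ ^ 2 + σ ^ 2 * ‖w‖ ^ 2 := by
      refine le_of_abs_le (abs_le_of_sq_le_sq ?_ (by positivity))
      nlinarith [sq_nonneg (0.9 * ‖p‖ ^ 2 - σ ^ 2 * ‖w‖ ^ 2)]
    linarith
  have h2 : ‖p - σ • w‖ ≤ ‖μ - x - σ • v‖ := by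
    have h3 : K.starProjection (μ - x - σ • v) = p - σ • w := by
      rw [map_sub, map_sub, map_smul, (Submodule.starProjection_apply_eq_zero_iff K).2 hx, sub_zero]
    rw [← h3]
    exact K.norm_starProjection_apply_le _
  have h4 : ‖μ - x - σ • v‖ ≤ ‖μ + σ₀ • u - x - σ • v‖ + σ₀ * ‖u‖ := by
    have h5 : μ - x - σ • v = (μ + σ₀ • u - x - σ • v) - σ₀ • u := by abel
    have h6 := norm_sub_le (μ + σ₀ • u - x - σ • v) (σ₀ • u)
    rw [← h5, norm_smul, Real.norm_eq_abs, abs_of_pos hσ₀] at h6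
    exact h6
  set s := √(lam * δ) with hs
  have hs2 : s ^ 2 = lam * δ := Real.sq_sqrt (by positivity)
  have hs0 : 0 < s := Real.sqrt_pos.2 (by positivity)
  have h7 : 2.5 * s ≤ ‖μ - x - σ • v‖ := by
    refine le_trans ?_ h2
    refine le_of_abs_le (abs_le_of_sq_le_sq ?_ (norm_nonneg _))
    nlinarith
  have h8 : σ₀ * ‖u‖ < s := by
    apply lt_of_pow_lt_pow_left₀ 2 hs0.le
    rw [hs2, mul_pow]
    nlinarith
  have h9 : 0 ≤ σ₀ * ‖u‖ := by positivity
  rw [← hs2, ← mul_pow]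
  have h10 : 2.5 * s - σ₀ * ‖u‖ ≤ ‖μ + σ₀ • u - x - σ • v‖ := by linarith
  -- With `a = σ₀‖u‖ < s`, `(2.5 s - a)² - a² - s² = 5.25 s² - 5 s a > 0`.
  have h11 : (2.5 * s - σ₀ * ‖u‖) ^ 2 ≤ ‖μ + σ₀ • u - x - σ • v‖ ^ 2 :=
    pow_le_pow_left₀ (by linarith) h10 2
  nlinarith [mul_pos hs0 (sub_pos.2 h8)]

/-! ### Design matrices, column spaces and the separation measure. -/

namespace Network

variable {V F : Type*} (D : Network V F) [Fintype V]

/-- `X_k` as a linear map. -/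
noncomputable def XLin (k : ℕ) : (D.Features k → ℝ) →ₗ[ℝ] D.Vec :=
  (WithLp.linearEquiv 2 ℝ (D.Untreated → ℝ)).symm.toLinearMap ∘ₗ (D.X k).mulVecLin

theorem XLin_apply (k : ℕ) (β : D.Features k → ℝ) : D.XLin k β = D.Xmul k β := rfl

theorem range_XLin (k : ℕ) : LinearMap.range (D.XLin k) = D.colSpace k := by
  rw [XLin, LinearMap.range_comp, Matrix.range_mulVecLin, Submodule.map_span, colSpace,
    ← Set.range_comp]
  rfl

theorem Xmul_mem_colSpace (k : ℕ) (β : D.Features k → ℝ) : D.Xmul k β ∈ D.colSpace k := by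
  rw [← range_XLin, ← XLin_apply]
  exact LinearMap.mem_range_self _ _

theorem Xmul_apply (k : ℕ) (β : D.Features k → ℝ) (i : D.Untreated) :
    D.Xmul k β i = β ⟨D.featureAt k i, i, rfl⟩ := by
  classical
  simp only [Xmul, X, Matrix.mulVec, dotProduct, Matrix.of_apply]
  rw [Finset.sum_eq_single ⟨D.featureAt k i, i, rfl⟩]
  · simp
  · intro g _ hg
    rw [if_neg, zero_mul]
    intro h
    exact hg (Subtype.ext h.symm)
  · simp

theorem finrank_vec : Module.finrank ℝ D.Vec = D.n₀ := finrank_euclideanSpace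

theorem n₀_le_card : D.n₀ ≤ Fintype.card V := Fintype.card_subtype_le _

theorem n₀_le_finrank_add_d (k : ℕ) : D.n₀ ≤ Module.finrank ℝ (D.colSpace k)ᗮ + D.d k := by
  have h1 := (D.colSpace k).finrank_add_finrank_orthogonal
  have h2 : Module.finrank ℝ (D.colSpace k) ≤ D.d k := finrank_range_le_card _
  rw [finrank_vec] at h1
  omega

theorem mean_apply (f : F → ℝ) (k₀ : ℕ) (i : D.Untreated) :
    D.mean f k₀ i = f (D.featureAt k₀ i) := by
  rw [mean, Xmul_apply]
  rfl

variable {D}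

theorem norm_mean_sq_le {f : F → ℝ} {k₀ : ℕ} {M : ℝ} (hM : ∀ i : V, |f (D.featureAt k₀ i)| ≤ M) :
    ‖D.mean f k₀‖ ^ 2 ≤ D.n₀ * M ^ 2 := by
  rw [EuclideanSpace.norm_sq_eq]
  calc ∑ i, ‖D.mean f k₀ i‖ ^ 2 ≤ ∑ _i : D.Untreated, M ^ 2 := by
        refine Finset.sum_le_sum fun i _ => ?_
        rw [mean_apply, Real.norm_eq_abs]
        exact pow_le_pow_left₀ (abs_nonneg _) (hM i) 2
    _ = _ := by rw [Finset.sum_const, nsmul_eq_mul, Finset.card_univ]; rfl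

/-- A bounded mean vector is fitted well by a model that has many distinct features. -/
theorem exists_norm_mean_sub_sq_le {f : F → ℝ} {k₀ : ℕ} {M : ℝ}
    (hM : ∀ i : V, |f (D.featureAt k₀ i)| ≤ M) (k : ℕ) :
    ∃ β, ‖D.mean f k₀ - D.Xmul k β‖ ^ 2 ≤
      4 * M ^ 2 * Module.finrank ℝ (D.colSpace k)ᗮ := by
  classical
  have hrep : ∀ g : D.Features k, ∃ i : D.Untreated, D.featureAt k i = g := fun g => g.2
  choose rep hrep using hrep
  have hinj : Function.Injective rep := by
    intro g g' h
    exact Subtype.ext (by rw [← hrep g, h, hrep g'])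
  -- Copying the mean from one representative per feature makes the error vanish at `d k` nodes; at
  -- each of the others it is at most `2 M`.
  refine ⟨fun g => D.mean f k₀ (rep g), ?_⟩
  rw [EuclideanSpace.norm_sq_eq]
  set R : Finset D.Untreated := Finset.univ.image rep with hR
  have hRcard : R.card = D.d k := by
    rw [hR, Finset.card_image_of_injective _ hinj]; rfl
  have hzero : ∀ i ∈ R, ‖(D.mean f k₀ - D.Xmul k fun g => D.mean f k₀ (rep g)) i‖ ^ 2 = 0 := by
    intro i hi
    obtain ⟨g, -, rfl⟩ := Finset.mem_image.1 hi
    have h1 : (⟨D.featureAt k (rep g), rep g, rfl⟩ : D.Features k) = g := Subtype.ext (hrep g)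
    rw [PiLp.sub_apply, Xmul_apply, h1, sub_self]
    simp
  rw [← Finset.sum_add_sum_compl R, Finset.sum_eq_zero hzero, zero_add]
  calc ∑ i ∈ Rᶜ, ‖(D.mean f k₀ - D.Xmul k fun g => D.mean f k₀ (rep g)) i‖ ^ 2
      ≤ ∑ _i ∈ Rᶜ, 4 * M ^ 2 := by
        refine Finset.sum_le_sum fun i _ => ?_
        rw [PiLp.sub_apply, Xmul_apply, mean_apply, mean_apply, Real.norm_eq_abs, sq_abs]
        have h1 := abs_le.1 (hM i)
        have h2 := abs_le.1 (hM (rep ⟨D.featureAt k i, i, rfl⟩))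
        nlinarith
    _ = (Rᶜ.card : ℝ) * (4 * M ^ 2) := by rw [Finset.sum_const, nsmul_eq_mul]
    _ ≤ _ := by
        have h1 : Rᶜ.card ≤ Module.finrank ℝ (D.colSpace k)ᗮ := by
          have h2 := R.card_add_card_compl
          have h3 := D.n₀_le_finrank_add_d k
          rw [n₀] at h3
          omega
        have h2 : (Rᶜ.card : ℝ) ≤ Module.finrank ℝ (D.colSpace k)ᗮ := by exact_mod_cast h1
        nlinarith [sq_nonneg M]

theorem Cmin_mul_le {f : F → ℝ} {k₀ : ℕ} (hn : 0 < D.n₀) {k : ℕ} (hk : k < k₀)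
    (β : D.Features k → ℝ) :
    D.Cmin f k₀ * (D.n₀ * ((k₀ : ℝ) - k)) ≤ ‖D.mean f k₀ - D.Xmul k β‖ ^ 2 := by
  have hk' : 0 < (k₀ : ℝ) - k := sub_pos.2 (by exact_mod_cast hk)
  have hn' : (0 : ℝ) < D.n₀ := by exact_mod_cast hn
  rw [← le_div_iff₀ (by positivity)]
  have hnonneg : ∀ (k : Fin k₀) (β : D.Features k → ℝ),
      0 ≤ ‖D.mean f k₀ - D.Xmul k β‖ ^ 2 / ((D.n₀ : ℝ) * ((k₀ : ℝ) - (k : ℕ))) := by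
    intro k β
    have : 0 < (k₀ : ℝ) - (k : ℕ) := sub_pos.2 (by exact_mod_cast k.2)
    positivity
  refine (ciInf_le ⟨0, Set.forall_mem_range.mpr fun k => Real.iInf_nonneg (hnonneg k)⟩
    (⟨k, hk⟩ : Fin k₀)).trans ?_
  exact ciInf_le ⟨0, Set.forall_mem_range.mpr fun β => hnonneg ⟨k, hk⟩ β⟩ β

theorem Cmin_mul_le_norm_starProjection_sq {f : F → ℝ} {k₀ : ℕ} (hn : 0 < D.n₀) {k : ℕ}
    (hk : k < k₀) :
    D.Cmin f k₀ * (D.n₀ * ((k₀ : ℝ) - k)) ≤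
      ‖(D.colSpace k)ᗮ.starProjection (D.mean f k₀)‖ ^ 2 := by
  have h := (D.colSpace k).starProjection_apply_mem (D.mean f k₀)
  rw [← range_XLin] at h
  obtain ⟨β, hβ⟩ := h
  have h1 := Cmin_mul_le (f := f) hn hk β
  rw [Submodule.starProjection_orthogonal_val, ← range_XLin, ← hβ]
  exact h1

/-- Separation bounds the fit error below and interpolation at representatives bounds it above by
the codimension: an under-specified model must leave many dimensions free. -/
theorem n₀_mul_Cmin_le_finrank {f : F → ℝ} {k₀ : ℕ} {M : ℝ}
    (hM : ∀ i : V, |f (D.featureAt k₀ i)| ≤ M) (hn : 0 < D.n₀) (hC : 0 ≤ D.Cmin f k₀)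
    {k : ℕ} (hk : k < k₀) :
    D.n₀ * D.Cmin f k₀ ≤ 4 * M ^ 2 * Module.finrank ℝ (D.colSpace k)ᗮ := by
  obtain ⟨β, hβ⟩ := exists_norm_mean_sub_sq_le hM k
  refine le_trans ?_ ((Cmin_mul_le hn hk β).trans hβ)
  have h1 : (1 : ℝ) ≤ (k₀ : ℝ) - k := by
    have : (k : ℝ) + 1 ≤ k₀ := by exact_mod_cast hk
    linarith
  nlinarith [mul_nonneg hC (Nat.cast_nonneg (α := ℝ) D.n₀)]

theorem mul_Cmin_le {f : F → ℝ} {k₀ : ℕ} {M : ℝ}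
    (hM : ∀ i : V, |f (D.featureAt k₀ i)| ≤ M) (hn : 0 < D.n₀) (hk : 1 ≤ k₀) :
    k₀ * D.Cmin f k₀ ≤ M ^ 2 := by
  -- The model `k = 0` with zero coefficients leaves the whole mean as error and has gap `k₀`.
  have h1 := Cmin_mul_le (f := f) hn hk 0
  rw [← XLin_apply, map_zero, sub_zero] at h1
  have h2 := h1.trans (norm_mean_sq_le hM)
  have hn' : (0 : ℝ) < D.n₀ := by exact_mod_cast hn
  simp only [Nat.cast_zero, sub_zero] at h2
  nlinarith

/-! ### Selection of the true model and the resulting confidence set. -/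

/-- `k` alone minimizes when every other model has an objective above one value at `k`. -/
theorem reproArgmin_eq_singleton {lam : ℝ} {y ustar : D.Vec} {k₀ : ℕ} (hk₀ : k₀ ≤ Fintype.card V)
    (β₀ : D.Features k₀ → ℝ) (σ₀ : ℝ)
    (h : ∀ k ≠ k₀, ∀ β σ, D.reproObj lam y ustar k₀ β₀ σ₀ < D.reproObj lam y ustar k β σ) :
    D.reproArgmin lam y ustar = {k₀} := by
  ext k
  constructor
  · rintro ⟨-, β, σ, hmin⟩
    by_contra hk
    exact absurd (hmin k₀ hk₀ β₀ σ₀) (not_le.2 (h k hk β σ))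
  · rintro rfl
    -- Attainment matters: were the set of minimizers empty, `pick` would be unconstrained.
    obtain ⟨p, hp⟩ := exists_forall_norm_sub_le
      ((D.XLin k).coprod (LinearMap.toSpanSingleton ℝ D.Vec ustar)) y
    have hp' : ∀ β σ, D.reproObj lam y ustar k p.1 p.2 ≤ D.reproObj lam y ustar k β σ := by
      intro β σ
      have h1 := hp (β, σ)
      simp only [LinearMap.coprod_apply, LinearMap.toSpanSingleton_apply, XLin_apply,
        ← sub_sub] at h1
      unfold reproObj
      gcongr
    refine ⟨hk₀, p.1, p.2, fun k' _ β' σ' => ?_⟩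
    by_cases hk' : k' = k
    · subst hk'
      exact hp' β' σ'
    · exact (hp' β₀ σ₀).trans (h k' hk' β' σ').le

theorem nuclearArgmin_singleton (lam' : ℝ) (k : ℕ) (Y : D.Vec) :
    D.nuclearArgmin lam' {k} Y = {k} := by
  ext j
  constructor
  · rintro ⟨h, -⟩
    exact Finset.mem_singleton.1 h
  · rintro rfl
    obtain ⟨p, hp⟩ := exists_forall_norm_sub_le (D.XLin j) Y
    refine ⟨Finset.mem_singleton_self _, p, fun k' hk' β' => ?_⟩
    obtain rfl := Finset.mem_singleton.1 hk'
    have := hp β'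
    simp only [XLin_apply] at this
    gcongr

theorem nuclear_singleton {pick : Set ℕ → ℕ} (hpick : ∀ s : Set ℕ, s.Nonempty → pick s ∈ s)
    (lam' : ℝ) (k : ℕ) (Y : D.Vec) : D.nuclear pick lam' {k} Y = k := by
  rw [nuclear, nuclearArgmin_singleton]
  exact hpick _ (Set.singleton_nonempty k)

/-- With one candidate, the observed and the simulated statistics all equal `k`, so `condF` is 1.
The bound `k ≤ n₀` is needed because `borelSet` only holds such values. -/
theorem mem_confidenceSet_singleton {pick : Set ℕ → ℕ}
    (hpick : ∀ s : Set ℕ, s.Nonempty → pick s ∈ s) (lam' : ℝ) {α : ℝ} (hα : α ≤ 1) {k : ℕ}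
    (hk : k ≤ D.n₀) (y : D.Vec) : k ∈ D.confidenceSet pick lam' α {k} y := by
  refine ⟨Finset.mem_singleton_self _, ?_⟩
  rw [nuclear_singleton hpick]
  refine ⟨hk, ?_⟩
  have h1 : D.condPMF pick lam' {k} k (D.W k y) k = 1 := by
    simp [condPMF, nuclear_singleton hpick]
  simp [condF, Finset.filter_singleton, h1, hα]

/-- The repro copies whose projection is almost parallel to the part of the mean that the model
`k` misses. -/
def alignedSet (D : Network V F) (f : F → ℝ) (k₀ k : ℕ) : Set D.Vec :=
  {v | 0.9 * (‖(D.colSpace k)ᗮ.starProjection (D.mean f k₀)‖ ^ 2 *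
    ‖(D.colSpace k)ᗮ.starProjection v‖ ^ 2) <
      (inner ℝ ((D.colSpace k)ᗮ.starProjection (D.mean f k₀)) v) ^ 2}

theorem measurableSet_alignedSet (f : F → ℝ) (k₀ k : ℕ) :
    MeasurableSet (D.alignedSet f k₀ k) :=
  (isOpen_lt (by fun_prop) (by fun_prop)).measurableSet

/-- Smaller models lose by their residual, since `v` cannot mimic the missed signal; larger ones
lose because one extra unit of penalty already exceeds the noise. -/
theorem reproArgmin_yobs {f : F → ℝ} {k₀ : ℕ} {lam σ₀ : ℝ} (hσ₀ : 0 < σ₀) (hn : 0 < D.n₀)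
    (hk₀ : k₀ ≤ Fintype.card V) (hlam : 62.5 * lam ≤ D.Cmin f k₀ * D.n₀) {u v : D.Vec}
    (hu : σ₀ ^ 2 * ‖u‖ ^ 2 < lam) (hv : ∀ k < k₀, v ∉ D.alignedSet f k₀ k) :
    D.reproArgmin lam (D.yobs f k₀ σ₀ u) v = {k₀} := by
  have hlam0 : 0 < lam := lt_of_le_of_lt (by positivity) hu
  refine reproArgmin_eq_singleton hk₀ (D.β₀ f k₀) 0 fun k hk β σ => ?_
  have h0 : D.reproObj lam (D.yobs f k₀ σ₀ u) v k₀ (D.β₀ f k₀) 0 =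
      σ₀ ^ 2 * ‖u‖ ^ 2 + lam * k₀ := by
    rw [reproObj, yobs, mean, zero_smul, sub_zero, add_sub_cancel_left, norm_smul, mul_pow,
      Real.norm_eq_abs, sq_abs]
  rw [h0]
  rcases lt_or_gt_of_ne hk with hk | hk
  · have hδ : (1 : ℝ) ≤ (k₀ : ℝ) - k := by
      have : (k : ℝ) + 1 ≤ k₀ := by exact_mod_cast hk
      linarith
    have hx : D.Xmul k β ∈ ((D.colSpace k)ᗮ)ᗮ := by
      rw [Submodule.orthogonal_orthogonal]
      exact D.Xmul_mem_colSpace k β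
    have hμ := Cmin_mul_le_norm_starProjection_sq (f := f) hn hk
    have := lt_norm_residual_sq (D.colSpace k)ᗮ (μ := D.mean f k₀) (v := v) hx σ hσ₀ hδ hu
      (le_trans (by nlinarith) hμ) (not_lt.1 (hv k hk))
    rw [reproObj, yobs]
    linarith
  · have h1 : (k₀ : ℝ) + 1 ≤ k := by exact_mod_cast hk
    have h2 := sq_nonneg ‖D.yobs f k₀ σ₀ u - D.Xmul k β - σ • v‖
    rw [reproObj]
    nlinarith

theorem mem_confidenceSet_yobs {f : F → ℝ} {k₀ : ℕ} {lam σ₀ : ℝ} (hσ₀ : 0 < σ₀) (hn : 0 < D.n₀)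
    (hk₀ : k₀ ≤ D.n₀) (hlam : 62.5 * lam ≤ D.Cmin f k₀ * D.n₀) {pick : Set ℕ → ℕ}
    (hpick : ∀ s : Set ℕ, s.Nonempty → pick s ∈ s) (lam' : ℝ) {α : ℝ} (hα : α ≤ 1) {B : ℕ}
    (hB : 1 ≤ B) {u : D.Vec} {v : Fin B → D.Vec}
    (hu : σ₀ ^ 2 * ‖u‖ ^ 2 < lam) (hv : ∀ b, ∀ k < k₀, v b ∉ D.alignedSet f k₀ k) :
    k₀ ∈ D.confidenceSet pick lam' α (D.candidateSet pick lam (D.yobs f k₀ σ₀ u) v)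
      (D.yobs f k₀ σ₀ u) := by
  have h1 : D.candidateSet pick lam (D.yobs f k₀ σ₀ u) v = {k₀} := by
    have : Nonempty (Fin B) := ⟨⟨0, hB⟩⟩
    have h2 : ∀ b, pick (D.reproArgmin lam (D.yobs f k₀ σ₀ u) (v b)) = k₀ := by
      intro b
      rw [reproArgmin_yobs hσ₀ hn (hk₀.trans D.n₀_le_card) hlam hu (hv b)]
      exact hpick _ (Set.singleton_nonempty k₀)
    rw [candidateSet]
    simp_rw [h2]
    exact Finset.image_const Finset.univ_nonempty k₀
  rw [h1]
  exact mem_confidenceSet_singleton hpick lam' hα hk₀ _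

/-! ### Union bound for the failure probability. -/

instance (B : ℕ) : IsProbabilityMeasure (D.jointLaw B) := by
  unfold jointLaw
  infer_instance

theorem jointLaw_fst {B : ℕ} {s : Set D.Vec} (hs : MeasurableSet s) :
    (D.jointLaw B).real {ω | ω.1 ∈ s} = (stdGaussian D.Vec).real s := by
  have : MeasurePreserving Prod.fst (D.jointLaw B) (stdGaussian D.Vec) := measurePreserving_fst
  exact this.measureReal_preimage hs.nullMeasurableSet

theorem jointLaw_snd {B : ℕ} (b : Fin B) {s : Set D.Vec} (hs : MeasurableSet s) :
    (D.jointLaw B).real {ω | ω.2 b ∈ s} = (stdGaussian D.Vec).real s := by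
  have h1 : MeasurePreserving Prod.snd (D.jointLaw B)
    (Measure.pi fun _ : Fin B => stdGaussian D.Vec) := measurePreserving_snd
  have h2 := (measurePreserving_eval (fun _ : Fin B => stdGaussian D.Vec) b).comp h1
  exact h2.measureReal_preimage hs.nullMeasurableSet

theorem one_sub_le_coverage {f : F → ℝ} {k₀ : ℕ} {lam σ₀ : ℝ} (hσ₀ : 0 < σ₀) (hn : 0 < D.n₀)
    (hk₀ : k₀ ≤ D.n₀) (hlam : 62.5 * lam ≤ D.Cmin f k₀ * D.n₀) {pick : Set ℕ → ℕ}
    (hpick : ∀ s : Set ℕ, s.Nonempty → pick s ∈ s) (lam' : ℝ) {α : ℝ} (hα : α ≤ 1) {B : ℕ}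
    (hB : 1 ≤ B) :
    1 - ((stdGaussian D.Vec).real {u | lam ≤ σ₀ ^ 2 * ‖u‖ ^ 2} +
      B * ∑ k ∈ Finset.range k₀, (stdGaussian D.Vec).real (D.alignedSet f k₀ k)) ≤
      D.coverage pick lam lam' α B f k₀ σ₀ := by
  set G : Set (D.Vec × (Fin B → D.Vec)) := {ω | k₀ ∈ D.confidenceSet pick lam' α
    (D.candidateSet pick lam (D.yobs f k₀ σ₀ ω.1) ω.2) (D.yobs f k₀ σ₀ ω.1)} with hG
  set N : Set D.Vec := {u | lam ≤ σ₀ ^ 2 * ‖u‖ ^ 2} with hN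
  have hNm : MeasurableSet N := (isClosed_le (by fun_prop) (by fun_prop)).measurableSet
  set A : Set (D.Vec × (Fin B → D.Vec)) :=
    ⋃ b ∈ (Finset.univ : Finset (Fin B)), ⋃ k ∈ Finset.range k₀, {ω | ω.2 b ∈ D.alignedSet f k₀ k}
    with hA
  -- Covering the whole space uses only subadditivity, so `G`, which depends on an arbitrary `pick`,
  -- need not be measurable.
  have hcover : Set.univ ⊆ G ∪ ({ω | ω.1 ∈ N} ∪ A) := by
    intro ω _
    by_cases h1 : ω.1 ∈ N
    · exact Or.inr (Or.inl h1)
    by_cases h2 : ω ∈ A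
    · exact Or.inr (Or.inr h2)
    refine Or.inl (mem_confidenceSet_yobs hσ₀ hn hk₀ hlam hpick lam' hα hB (not_le.1 h1) ?_)
    intro b k hk h3
    refine h2 ?_
    simp only [hA, Set.mem_iUnion]
    exact ⟨b, Finset.mem_univ _, k, Finset.mem_range.2 hk, h3⟩
  have h1 : 1 ≤ (D.jointLaw B).real G + ((D.jointLaw B).real {ω | ω.1 ∈ N} +
      (D.jointLaw B).real A) := by
    calc (1 : ℝ) = (D.jointLaw B).real Set.univ := probReal_univ.symm
      _ ≤ (D.jointLaw B).real (G ∪ ({ω | ω.1 ∈ N} ∪ A)) := measureReal_mono hcover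
      _ ≤ (D.jointLaw B).real G + (D.jointLaw B).real ({ω | ω.1 ∈ N} ∪ A) :=
        measureReal_union_le _ _
      _ ≤ _ := by gcongr; exact measureReal_union_le _ _
  have h2 : (D.jointLaw B).real A ≤
      B * ∑ k ∈ Finset.range k₀, (stdGaussian D.Vec).real (D.alignedSet f k₀ k) := by
    calc (D.jointLaw B).real A
        ≤ ∑ b : Fin B, ∑ k ∈ Finset.range k₀,
          (D.jointLaw B).real {ω | ω.2 b ∈ D.alignedSet f k₀ k} :=
          (measureReal_biUnion_finset_le _ _).trans
            (Finset.sum_le_sum fun b _ => measureReal_biUnion_finset_le _ _)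
      _ = _ := by
          simp_rw [jointLaw_snd _ (measurableSet_alignedSet f k₀ _)]
          rw [Finset.sum_const, nsmul_eq_mul, Finset.card_univ, Fintype.card_fin]
  rw [jointLaw_fst hNm] at h1
  change _ ≤ (D.jointLaw B).real G
  linarith

/-- Chance that the noise or a repro copy is atypical, when the penalty lies in the window. -/
theorem coverage_error_le {f : F → ℝ} {k₀ : ℕ} {lam σ₀ m M : ℝ} (hσ₀ : 0 < σ₀) (hm : 0 < m)
    (hM : ∀ i : V, |f (D.featureAt k₀ i)| ≤ M) (hn : 0 < D.n₀) (hk₀ : 1 ≤ k₀)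
    (hlam : D.n₀ * (σ₀ ^ 2 + m) ≤ lam) (hC : σ₀ ^ 2 ≤ D.Cmin f k₀) (B : ℕ) :
    (stdGaussian D.Vec).real {u | lam ≤ σ₀ ^ 2 * ‖u‖ ^ 2} +
      B * ∑ k ∈ Finset.range k₀, (stdGaussian D.Vec).real (D.alignedSet f k₀ k) ≤
    Real.exp (-(min (m / σ₀ ^ 2 / 4) (1 / 4) * (m / σ₀ ^ 2) / 2) * D.n₀) +
      B * (M ^ 2 / σ₀ ^ 2) * 4 *
        Real.exp (-(Real.log 2 * (σ₀ ^ 2 / (4 * (M ^ 2 + 1)))) * D.n₀) := by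
  have hσ2 : 0 < σ₀ ^ 2 := by positivity
  have hn' : (0 : ℝ) < D.n₀ := by exact_mod_cast hn
  refine add_le_add ?_ ?_
  · have h1 := stdGaussian_norm_sq_tail (E := D.Vec) (t := m / σ₀ ^ 2) (by positivity)
    rw [finrank_vec] at h1
    refine le_trans (measureReal_mono ?_) h1
    intro u hu
    have hu' : lam ≤ σ₀ ^ 2 * ‖u‖ ^ 2 := hu
    change (D.n₀ : ℝ) * (1 + m / σ₀ ^ 2) ≤ ‖u‖ ^ 2
    rw [← mul_le_mul_iff_right₀ hσ2]
    refine le_trans (le_of_eq ?_) (hlam.trans hu')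
    field_simp
  · rw [mul_assoc, mul_assoc]
    refine mul_le_mul_of_nonneg_left ?_ (Nat.cast_nonneg B)
    have hk : ∀ k ∈ Finset.range k₀, (stdGaussian D.Vec).real (D.alignedSet f k₀ k) ≤
        4 * Real.exp (-(Real.log 2 * (σ₀ ^ 2 / (4 * (M ^ 2 + 1)))) * D.n₀) := by
      intro k hk
      refine (stdGaussian_alignment_tail (D.colSpace k)ᗮ
        (Submodule.starProjection_apply_mem _ _)).trans ?_
      gcongr
      have h1 := n₀_mul_Cmin_le_finrank hM hn (hσ2.le.trans hC) (Finset.mem_range.1 hk)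
      set r := Module.finrank ℝ (D.colSpace k)ᗮ with hr
      have h2 : ((1 : ℝ) / 2) ^ r = Real.exp (-(Real.log 2 * r)) := by
        rw [mul_comm, ← mul_neg, ← Real.log_inv, Real.exp_nat_mul, Real.exp_log (by norm_num)]
        norm_num
      rw [h2]
      apply Real.exp_le_exp.2
      rw [neg_mul, neg_le_neg_iff, mul_assoc]
      refine mul_le_mul_of_nonneg_left ?_ (Real.log_nonneg (by norm_num))
      -- The constant has `M ^ 2 + 1` instead of `M ^ 2` so that the denominator is positive even if
      -- `M = 0`.
      rw [div_mul_eq_mul_div, div_le_iff₀ (by positivity)]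
      nlinarith [Nat.cast_nonneg (α := ℝ) r]
    refine (Finset.sum_le_sum hk).trans ?_
    rw [Finset.sum_const, Finset.card_range, nsmul_eq_mul]
    gcongr
    rw [le_div_iff₀ hσ2]
    refine le_trans ?_ (mul_Cmin_le hM hn hk₀)
    gcongr

end Network

end HNCI

/-! ### Uniform constants and conclusion. -/

theorem theorem5 (σ₀ m₁ m₂ M α : ℝ) (hσ₀ : 0 < σ₀) (hm₁ : 0 < m₁) (hm₂ : 0 < m₂)
    (hα₀ : 0 < α) (hα₁ : α < 1) (B : ℕ) (hB : 1 ≤ B) :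
    ∃ c₂ : ℝ, 0 < c₂ ∧ ∃ r : ℕ → ℝ,
      r =o[atTop] (fun n : ℕ => Real.exp (-c₂ * (n : ℝ))) ∧
      ∀ (V : Type*) [Fintype V] (F : Type*) (D : HNCI.Network V F) (f : F → ℝ) (k₀ : ℕ)
        (lam lam' : ℝ) (pick : Set ℕ → ℕ),
        (∀ s : Set ℕ, s.Nonempty → pick s ∈ s) →
        D.NestedMatching →
        (∀ i : V, |f (D.featureAt k₀ i)| ≤ M) →
        1 ≤ k₀ →
        D.Identifiable f k₀ →
        lam / (D.n₀ : ℝ) ∈ Set.Icc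
          ((σ₀ ^ 2 + 2 * σ₀ ^ 2 / (D.n₀ : ℝ)) + m₁)
          (min (0.015 * D.Cmin f k₀ - 3 * σ₀ ^ 2 * Real.log 2 / (D.n₀ : ℝ))
            (0.015 * D.Cmin f k₀ - σ₀ ^ 2 * (D.d k₀ : ℝ) / (D.n₀ : ℝ)) - m₂) →
        Real.log (2 * (k₀ : ℝ)) / ((D.n₀ : ℝ) - (D.d k₀ : ℝ) - 1) < Real.log (5 / 3) →
        1 - α - r D.n₀ ≤ D.coverage pick lam lam' α B f k₀ σ₀ := by
  set c : ℝ := min (m₁ / σ₀ ^ 2 / 4) (1 / 4) * (m₁ / σ₀ ^ 2) / 2 with hc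
  set c' : ℝ := Real.log 2 * (σ₀ ^ 2 / (4 * (M ^ 2 + 1))) with hc'
  have hc0 : 0 < c := by positivity
  have hc0' : 0 < c' := by
    have : 0 < Real.log 2 := Real.log_pos (by norm_num)
    positivity
  have hlittle : ∀ a b : ℝ, b < a → (fun n : ℕ => Real.exp (-a * (n : ℝ))) =o[atTop]
      (fun n : ℕ => Real.exp (-b * (n : ℝ))) := by
    intro a b hab
    rw [Real.isLittleO_exp_comp_exp_comp]
    have h1 : Tendsto (fun n : ℕ => (a - b) * (n : ℝ)) atTop atTop :=
      tendsto_natCast_atTop_atTop.const_mul_atTop (sub_pos.2 hab)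
    refine h1.congr fun n => by ring
  have hmin : 0 < min c c' := lt_min hc0 hc0'
  -- Halving the smaller rate turns exponential decay into little-o. The finitely many `n ≤ M²/σ₀²`
  -- get the trivial error 1; beyond them `k₀ ≤ n₀` is automatic.
  refine ⟨min c c' / 2, by positivity,
    fun n => if (n : ℝ) ≤ M ^ 2 / σ₀ ^ 2 then 1 else
      Real.exp (-c * n) + B * (M ^ 2 / σ₀ ^ 2) * 4 * Real.exp (-c' * n), ?_, ?_⟩
  · have h1 := (hlittle c (min c c' / 2) (by linarith [min_le_left c c'])).add
      ((hlittle c' (min c c' / 2) (by linarith [min_le_right c c'])).const_mul_left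
        (B * (M ^ 2 / σ₀ ^ 2) * 4))
    refine h1.congr' ?_ EventuallyEq.rfl
    filter_upwards [tendsto_natCast_atTop_atTop.eventually_gt_atTop (M ^ 2 / σ₀ ^ 2)] with n hn
    rw [if_neg (not_le.2 hn)]
  · intro V _ F D f k₀ lam lam' pick hpick _ hM hk₀ _ hlam _
    have hcov : 0 ≤ D.coverage pick lam lam' α B f k₀ σ₀ := measureReal_nonneg
    by_cases hsmall : (D.n₀ : ℝ) ≤ M ^ 2 / σ₀ ^ 2
    · simp only [if_pos hsmall]
      linarith
    simp only [if_neg hsmall]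
    have hσ2 : 0 < σ₀ ^ 2 := by positivity
    have hn' : (0 : ℝ) < D.n₀ := lt_of_le_of_lt (by positivity) (not_le.1 hsmall)
    have hn : 0 < D.n₀ := by exact_mod_cast hn'
    have hlo : (σ₀ ^ 2 + m₁) * D.n₀ ≤ lam := by
      rw [← le_div_iff₀ hn']
      have : 0 ≤ 2 * σ₀ ^ 2 / (D.n₀ : ℝ) := by positivity
      linarith [hlam.1]
    have hhi : lam / D.n₀ ≤ 0.015 * D.Cmin f k₀ := by
      have h1 : 0 ≤ σ₀ ^ 2 * (D.d k₀ : ℝ) / (D.n₀ : ℝ) := by positivity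
      have h2 := hlam.2.trans (sub_le_sub_right (min_le_right _ _) _)
      linarith
    have hC : σ₀ ^ 2 ≤ D.Cmin f k₀ := by
      have h1 := (le_div_iff₀ hn').2 hlo
      norm_num at hhi
      linarith
    -- There is room here: `62.5 * 0.015 = 0.9375 < 1`.
    have hup : 62.5 * lam ≤ D.Cmin f k₀ * D.n₀ := by
      rw [div_le_iff₀ hn'] at hhi
      have : 0 ≤ D.Cmin f k₀ * D.n₀ := mul_nonneg (hσ2.le.trans hC) hn'.le
      norm_num at hhi ⊢
      linarith
    have hk₀n : k₀ ≤ D.n₀ := by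
      have h1 := HNCI.Network.mul_Cmin_le hM hn hk₀
      have h2 : (k₀ : ℝ) ≤ M ^ 2 / σ₀ ^ 2 := by
        rw [le_div_iff₀ hσ2]
        exact le_trans (by gcongr) h1
      exact_mod_cast h2.trans (not_le.1 hsmall).le
    have h1 := HNCI.Network.one_sub_le_coverage hσ₀ hn hk₀n hup hpick lam' hα₁.le hB
    have h2 := HNCI.Network.coverage_error_le (lam := lam) hσ₀ hm₁ hM hn hk₀ (by linarith) hC B
    rw [← hc, ← hc'] at h2
    linarith
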